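/- For $k\in\mathbb{N}=\{0,1,2,\dots\}$ let $$h_k(x)=\pi^{-1/4}\,(k!)^{-1/2}\,2^{-k/2}\,(-1)^k\,e^{x^2/2}\,\frac{d^k}{dx^k}e^{-x^2}\qquad(x\in\mathbb{R})$$ be the normalized one-dimensional Hermite functions, and for a multi-index $\mu=(\mu_1,\dots,\mu_n)\in\mathbb{N}^n$ let $H_\mu(x)=\prod_{j=1}^n h_{\mu_j}(x_j)$ for $x\in\mathbb{R}^n$, and $|\mu|=\sum_{j=1}^n\mu_j$. For $\psi\in L^2(\mathbb{R}^n)$ let $$\mathcal{W}_\psi(x,y)=(2\pi)^{-n}\int_{\mathbb{R}^n}\psi(x+\tau/2)\,\overline{\psi(x-\tau/2)}\,e^{-i\tau\cdot y}\,d\tau\qquad(x,y\in\mathbb{R}^n)$$ be its Wigner distribution, and let $B^{2n}(r)=\{(x,y)\in\mathbb{R}^n\times\mathbb{R}^n : |x|^2+|y|^2\le r^2\}$ be the centered Euclidean ball of radius $r$ in $\mathbb{R}^{2n}$. Then for every integer $\lambda\ge 0$, all multi-indices $\mu,\nu\in\mathbb{N}^n$ with $|\mu|=|\nu|=\lambda$,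 and every real $r\ge 0$, the functions $\mathcal{W}_{H_\mu}$ and $\mathcal{W}_{H_\nu}$ are integrable on $B^{2n}(r)$ and $$\int_{B^{2n}(r)}\mathcal{W}_{H_\mu}(x,y)\,dx\,dy=\int_{B^{2n}(r)}\mathcal{W}_{H_\nu}(x,y)\,dx\,dy .$$ -/

import Mathlib

open MeasureTheory

noncomputable section

/-- The normalized one-dimensional Hermite function
`h_k(x) = π^(-1/4) (k!)^(-1/2) 2^(-k/2) (-1)^k e^(x²/2) (d^k/dx^k) e^(-x²)`. -/
def hermiteFun (k : ℕ) (x : ℝ) : ℝ :=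
  Real.pi ^ (-(1 / 4 : ℝ)) * (Nat.factorial k : ℝ) ^ (-(1 / 2 : ℝ)) * (2 : ℝ) ^ (-((k : ℝ) / 2)) *
    (-1) ^ k * Real.exp (x ^ 2 / 2) * iteratedDeriv k (fun t : ℝ => Real.exp (-t ^ 2)) x

/-- The Hermite function `H_μ(x) = ∏ j, h_{μ_j}(x_j)` on `ℝⁿ`, as a complex-valued function. -/
def multiHermite {n : ℕ} (μ : Fin n → ℕ) (x : EuclideanSpace ℝ (Fin n)) : ℂ :=
  ((∏ j, hermiteFun (μ j) (x j) : ℝ) : ℂ)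

/-- The Wigner distribution of `ψ` at the point `z = (x, y)` of phase space:
`(2π)^(-n) ∫ ψ(x + τ/2) ψ*(x - τ/2) e^(-i τ·y) dτ`. -/
def wigner {n : ℕ} (ψ : EuclideanSpace ℝ (Fin n) → ℂ)
    (z : EuclideanSpace ℝ (Fin n) × EuclideanSpace ℝ (Fin n)) : ℂ :=
  ((2 * Real.pi : ℝ) : ℂ)⁻¹ ^ n *
    ∫ τ : EuclideanSpace ℝ (Fin n),
      ψ (z.1 + (1 / 2 : ℝ) • τ) * (starRingEnd ℂ) (ψ (z.1 - (1 / 2 : ℝ) • τ)) *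
        Complex.exp (-Complex.I * ((inner ℝ τ z.2 : ℝ) : ℂ))

/-- The closed Euclidean ball of radius `r` centered at the origin of `ℝ²ⁿ`, in the coordinates
`(x, y)`. The product measure on pairs is Lebesgue measure `dx dy`; the product norm on pairs
is not Euclidean, so the ball is spelled out. -/
def phaseBall (n : ℕ) (r : ℝ) :
    Set (EuclideanSpace ℝ (Fin n) × EuclideanSpace ℝ (Fin n)) :=
  {z | ‖z.1‖ ^ 2 + ‖z.2‖ ^ 2 ≤ r ^ 2}

end

/-! Write `s_j = x_j² + y_j²`. The Wigner distribution of `H_μ` is `π^(-n) e^(-|z|²) ∏ j, (-1)^(μ_j)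
L_{μ_j}(2 s_j)`, and `(-1)^k L_k(2s)` is `(2X - 1)^k` with each `X^m` replaced by `s^m / m!`.

The integral of `e^(-|z|²) ∏ j, s_j^(m_j) / m_j!` over a ball depends only on `M = ∑ j, m_j`.
Indeed, for a homogeneous density the distribution of `|z|²` is fixed by its degree up to a
constant, and that constant is fixed by the integral over the whole space, which is `π^n` for every
`m` (`integral_exp_mul_actionMonomial`). Call the common value `c(X^M)` and extend `c` linearly to
polynomials. The ball integral is then `π^(-n) c(∏ j, (2X - 1)^(μ_j)) = π^(-n) c((2X - 1)^|μ|)`,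
which sees only `|μ|`.

The Laguerre formula comes from integration by parts, which gives a ladder recurrence
(`hermiteCross_succ_left`, `sum_of_ladder_recurrence`). The homogeneity argument is
`setIntegral_gaussian_mul_eq_of_homogeneous`. -/

noncomputable section

/-! ### Hermite polynomials and Hermite functions -/

section HermitePolynomials
open Polynomial

/-- The physicists' Hermite polynomials. -/
def physHermite : ℕ → ℝ[X]
  | 0 => 1
  | k + 1 => C 2 * X * physHermite k - derivative (physHermite k)

theorem derivative_physHermite_succ (k : ℕ) :
    derivative (physHermite (k + 1)) = C (2 * (k + 1) : ℝ) * physHermite k := by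
  induction k with
  | zero => simp [physHermite]
  | succ k ih =>
    have h : physHermite (k + 1) = C 2 * X * physHermite k - derivative (physHermite k) := rfl
    have e1 : (C (2 * ((k + 1 : ℕ) + 1) : ℝ) : ℝ[X]) = C (2 * (k + 1) : ℝ) + C 2 := by
      rw [← C_add]; push_cast; ring_nf
    have e2 : derivative (C (2 * (k + 1) : ℝ) * physHermite k)
        = C (2 * (k + 1) : ℝ) * derivative (physHermite k) := by simp
    rw [physHermite, derivative_sub, ih, e2, e1]
    simp only [derivative_mul, derivative_C, derivative_X, ih, zero_mul, zero_add]
    rw [h]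
    ring

/-- At `k = 0` the truncated index `k - 1` is harmless because its coefficient vanishes; the
recurrences below use the same convention. -/
theorem derivative_physHermite (k : ℕ) :
    derivative (physHermite k) = C (2 * k : ℝ) * physHermite (k - 1) := by
  cases k with
  | zero => simp [physHermite]
  | succ k => simp [derivative_physHermite_succ]

theorem iteratedDeriv_exp_neg_sq (k : ℕ) :
    iteratedDeriv k (fun t : ℝ => Real.exp (-t ^ 2)) =
      fun x => (-1) ^ k * (physHermite k).eval x * Real.exp (-x ^ 2) := by
  induction k with
  | zero => funext x; simp [physHermite]
  | succ k ih =>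
    rw [iteratedDeriv_succ, ih]
    funext x
    have h1 := ((physHermite k).hasDerivAt x).const_mul ((-1 : ℝ) ^ k)
    have h2 : HasDerivAt (fun t : ℝ => Real.exp (-t ^ 2)) (Real.exp (-x ^ 2) * (-(2 * x))) x := by
      simpa using ((hasDerivAt_pow 2 x).neg).exp
    refine (h1.mul h2).deriv.trans ?_
    simp only [physHermite, eval_sub, eval_mul, eval_C, eval_X]
    ring

theorem hermiteFun_eq (k : ℕ) (x : ℝ) :
    hermiteFun k x = Real.pi ^ (-(1 / 4 : ℝ)) * (Nat.factorial k : ℝ) ^ (-(1 / 2 : ℝ)) *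
      (2 : ℝ) ^ (-((k : ℝ) / 2)) * (physHermite k).eval x * Real.exp (-x ^ 2 / 2) := by
  rw [hermiteFun, iteratedDeriv_exp_neg_sq]
  have h1 : Real.exp (x ^ 2 / 2) * Real.exp (-x ^ 2) = Real.exp (-x ^ 2 / 2) := by
    rw [← Real.exp_add]; ring_nf
  have h2 : ((-1 : ℝ) ^ k) * (-1) ^ k = 1 := by rw [← mul_pow]; simp
  rw [← h1]
  linear_combination (Real.pi ^ (-(1 / 4 : ℝ)) * (Nat.factorial k : ℝ) ^ (-(1 / 2 : ℝ)) *
      (2 : ℝ) ^ (-((k : ℝ) / 2)) * (physHermite k).eval x *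
      (Real.exp (x ^ 2 / 2) * Real.exp (-x ^ 2))) * h2

theorem hermiteFun_mul (k : ℕ) (x y : ℝ) :
    hermiteFun k x * hermiteFun k y = Real.pi ^ (-(1 / 2 : ℝ)) * (2 ^ k * Nat.factorial k : ℝ)⁻¹ *
      ((physHermite k).eval x * (physHermite k).eval y * Real.exp (-(x ^ 2 + y ^ 2) / 2)) := by
  rw [hermiteFun_eq, hermiteFun_eq]
  have h1 : Real.pi ^ (-(1 / 4 : ℝ)) * Real.pi ^ (-(1 / 4 : ℝ)) = Real.pi ^ (-(1 / 2 : ℝ)) := by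
    rw [← Real.rpow_add Real.pi_pos]; norm_num
  have h2 : (Nat.factorial k : ℝ) ^ (-(1 / 2 : ℝ)) * (Nat.factorial k : ℝ) ^ (-(1 / 2 : ℝ))
      = (Nat.factorial k : ℝ)⁻¹ := by
    rw [← Real.rpow_add (by positivity), ← Real.rpow_neg_one]; norm_num
  have h3 : (2 : ℝ) ^ (-((k : ℝ) / 2)) * (2 : ℝ) ^ (-((k : ℝ) / 2)) = ((2 : ℝ) ^ k)⁻¹ := by
    rw [← Real.rpow_add (by positivity), ← Real.rpow_natCast, ← Real.rpow_neg (by positivity)]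
    ring_nf
  have h4 : Real.exp (-(x ^ 2 + y ^ 2) / 2) = Real.exp (-x ^ 2 / 2) * Real.exp (-y ^ 2 / 2) := by
    rw [← Real.exp_add]; ring_nf
  rw [h4, mul_inv, ← h1, ← h2, ← h3]
  ring

end HermitePolynomials

/-! ### The one-dimensional Wigner integral and Laguerre polynomials -/

section GaussianFunctional
open Polynomial

/-- The Gaussian weight of the Fourier transform at frequency `y`. -/
def fourierGaussianWeight (y τ : ℝ) : ℂ :=
  Complex.exp (-(τ : ℂ) ^ 2 / 4 - Complex.I * τ * y)

/-- The Fourier transform at `y` of the polynomial `q` times `exp (-τ² / 4)`. -/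
def gaussianFourier (y : ℝ) (q : ℂ[X]) : ℂ :=
  ∫ τ : ℝ, q.eval (τ : ℂ) * fourierGaussianWeight y τ

theorem continuous_fourierGaussianWeight (y : ℝ) : Continuous (fourierGaussianWeight y) := by
  unfold fourierGaussianWeight; fun_prop

theorem norm_fourierGaussianWeight (y τ : ℝ) :
    ‖fourierGaussianWeight y τ‖ = Real.exp (-(1 / 4) * τ ^ 2) := by
  rw [fourierGaussianWeight, Complex.norm_exp]
  congr 1
  simp [← Complex.ofReal_pow]
  ring

theorem integrable_eval_mul_fourierGaussianWeight (y : ℝ) (q : ℂ[X]) :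
    Integrable (fun τ : ℝ => q.eval (τ : ℂ) * fourierGaussianWeight y τ) := by
  induction q using Polynomial.induction_on' with
  | add p q hp hq => simp only [eval_add, add_mul]; exact hp.add hq
  | monomial n a =>
    have h := integrable_rpow_mul_exp_neg_mul_sq (b := 1 / 4) (by norm_num) (s := n)
      (by have : (0 : ℝ) ≤ n := n.cast_nonneg
          linarith)
    have h2 : Integrable (fun τ : ℝ => ‖a‖ * (τ ^ (n : ℝ) * Real.exp (-(1 / 4) * τ ^ 2))) :=
      h.const_mul _
    refine h2.mono ?_ (Filter.Eventually.of_forall fun τ => ?_)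
    · have := continuous_fourierGaussianWeight y
      exact Continuous.aestronglyMeasurable (by fun_prop)
    · simp [norm_fourierGaussianWeight, mul_assoc]

theorem gaussianFourier_add (y : ℝ) (p q : ℂ[X]) :
    gaussianFourier y (p + q) = gaussianFourier y p + gaussianFourier y q := by
  rw [gaussianFourier, gaussianFourier, gaussianFourier, ← integral_add
    (integrable_eval_mul_fourierGaussianWeight y p) (integrable_eval_mul_fourierGaussianWeight y q)]
  simp [add_mul]

theorem gaussianFourier_C_mul (y : ℝ) (c : ℂ) (q : ℂ[X]) :
    gaussianFourier y (C c * q) = c * gaussianFourier y q := by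
  rw [gaussianFourier, gaussianFourier, ← integral_const_mul]
  simp [mul_assoc]

theorem hasDerivAt_fourierGaussianWeight (y τ : ℝ) :
    HasDerivAt (fourierGaussianWeight y)
      (-((τ : ℂ) / 2 + Complex.I * y) * fourierGaussianWeight y τ) τ := by
  have h0 : HasDerivAt (fun t : ℂ => -t ^ 2 / 4 - Complex.I * t * y)
      (-(2 * (τ : ℂ)) / 4 - Complex.I * y) τ := by
    have h1 : HasDerivAt (fun t : ℂ => -t ^ 2 / 4) (-(2 * (τ : ℂ)) / 4) τ := by
      simpa using ((hasDerivAt_pow 2 (τ : ℂ)).neg).div_const 4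
    have h2 : HasDerivAt (fun t : ℂ => Complex.I * t * y) (Complex.I * y) τ := by
      simpa using ((hasDerivAt_id (τ : ℂ)).const_mul Complex.I).mul_const (y : ℂ)
    exact h1.sub h2
  have h := h0.cexp.comp_ofReal
  convert! h using 1
  simp only [fourierGaussianWeight]
  ring

/-- Integration by parts: the weight has logarithmic derivative `-(τ/2 + iy)`, and the total
derivative integrates to zero. -/
theorem gaussianFourier_derivative (y : ℝ) (q : ℂ[X]) :
    gaussianFourier y (derivative q) =
      gaussianFourier y ((C (1 / 2) * X + C (Complex.I * y)) * q) := by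
  have hd : ∀ τ : ℝ, HasDerivAt (fun τ : ℝ => q.eval (τ : ℂ) * fourierGaussianWeight y τ)
      ((derivative q + C (-1) * ((C (1 / 2) * X + C (Complex.I * y)) * q)).eval (τ : ℂ) *
        fourierGaussianWeight y τ) τ := fun τ => by
    convert! (q.hasDerivAt (τ : ℂ)).comp_ofReal.mul (hasDerivAt_fourierGaussianWeight y τ) using 1
    simp
    ring
  have h := integral_eq_zero_of_hasDerivAt_of_integrable hd
    (integrable_eval_mul_fourierGaussianWeight y _) (integrable_eval_mul_fourierGaussianWeight y _)
  have h' : gaussianFourier y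
      (derivative q + C (-1) * ((C (1 / 2) * X + C (Complex.I * y)) * q)) = 0 := h
  rw [gaussianFourier_add, gaussianFourier_C_mul] at h'
  linear_combination h'

theorem gaussianFourier_one (y : ℝ) :
    gaussianFourier y 1 = (Real.pi / (1 / 4) : ℂ) ^ (1 / 2 : ℂ) * Real.exp (-y ^ 2) := by
  have h := fourierIntegral_gaussian (b := 1 / 4) (by norm_num) (-y : ℂ)
  rw [gaussianFourier]
  convert h using 2
  · funext τ
    rw [fourierGaussianWeight, ← Complex.exp_add]
    simp
    ring_nf
  · push_cast
    ring_nf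

/-- The polynomial `τ ↦ H_k (x + c τ)` over the complex numbers. -/
def shiftedHermite (x c : ℂ) (k : ℕ) : ℂ[X] :=
  ((physHermite k).map (algebraMap ℝ ℂ)).comp (C x + C c * X)

theorem derivative_shiftedHermite (x c : ℂ) (k : ℕ) :
    derivative (shiftedHermite x c k) = C (c * (2 * k)) * shiftedHermite x c (k - 1) := by
  rw [shiftedHermite, derivative_comp, derivative_map, derivative_physHermite]
  simp [shiftedHermite]
  ring

theorem shiftedHermite_succ (x c : ℂ) (k : ℕ) :
    shiftedHermite x c (k + 1) = C 2 * (C x + C c * X) * shiftedHermite x c k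
      - C (2 * (k : ℂ)) * shiftedHermite x c (k - 1) := by
  simp only [shiftedHermite, physHermite, derivative_physHermite]
  simp

theorem shiftedHermite_zero (x c : ℂ) : shiftedHermite x c 0 = 1 := by
  simp [shiftedHermite, physHermite]

/-- The cross-Wigner integral of two Hermite polynomials. -/
def hermiteCross (x y : ℝ) (j k : ℕ) : ℂ :=
  gaussianFourier y (shiftedHermite x (1 / 2) j * shiftedHermite x (-(1 / 2)) k)

/-- In the three-term recurrence split `2(x + τ/2) = 2(x - iy) + 2(τ/2 + iy)` and integrate the last
term by parts. The derivative falling on the first factor cancels the `-2j` term; the one falling on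
the second leaves `-2k`. -/
theorem hermiteCross_succ_left (x y : ℝ) (j k : ℕ) :
    hermiteCross x y (j + 1) k = 2 * (x - Complex.I * y) * hermiteCross x y j k
      - 2 * k * hermiteCross x y j (k - 1) := by
  have hp := gaussianFourier_derivative y
    (shiftedHermite x (1 / 2) j * shiftedHermite x (-(1 / 2)) k)
  rw [derivative_mul, derivative_shiftedHermite, derivative_shiftedHermite] at hp
  have e : shiftedHermite x (1 / 2) (j + 1) * shiftedHermite x (-(1 / 2)) k =
      C (2 * (x - Complex.I * y)) *
          (shiftedHermite x (1 / 2) j * shiftedHermite x (-(1 / 2)) k)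
      + (C 2 * ((C (1 / 2) * X + C (Complex.I * y)) *
          (shiftedHermite x (1 / 2) j * shiftedHermite x (-(1 / 2)) k))
      + C (-(2 * (j : ℂ))) *
          (shiftedHermite x (1 / 2) (j - 1) * shiftedHermite x (-(1 / 2)) k)) := by
    rw [shiftedHermite_succ]
    simp only [C_mul, C_sub, C_neg]
    ring
  rw [hermiteCross, e, gaussianFourier_add, gaussianFourier_add, gaussianFourier_C_mul,
    gaussianFourier_C_mul, gaussianFourier_C_mul, ← hp, gaussianFourier_add]
  rw [mul_assoc (C _), gaussianFourier_C_mul, mul_left_comm (shiftedHermite _ _ j), gaussianFourier_C_mul]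
  simp only [hermiteCross]
  ring

theorem hermiteCross_zero_succ (x y : ℝ) (k : ℕ) :
    hermiteCross x y 0 (k + 1) = 2 * (x + Complex.I * y) * hermiteCross x y 0 k := by
  have hp := gaussianFourier_derivative y (shiftedHermite x (-(1 / 2)) k)
  rw [derivative_shiftedHermite] at hp
  have e : shiftedHermite x (-(1 / 2)) (k + 1) =
      C (2 * (x + Complex.I * y)) * shiftedHermite x (-(1 / 2)) k
      + (C (-2) * ((C (1 / 2) * X + C (Complex.I * y)) * shiftedHermite x (-(1 / 2)) k)
      + C (-(2 * (k : ℂ))) * shiftedHermite x (-(1 / 2)) (k - 1)) := by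
    rw [shiftedHermite_succ]
    simp only [C_mul, C_add, C_neg]
    ring
  simp only [hermiteCross, shiftedHermite_zero, one_mul]
  rw [e, gaussianFourier_add, gaussianFourier_add, gaussianFourier_C_mul,
    gaussianFourier_C_mul, gaussianFourier_C_mul, ← hp, gaussianFourier_C_mul]
  ring

/-- Induction on `j`: Pascal's rule splits each coefficient, and `(l + 1) C(k, l + 1) = k C(k - 1,
l)` matches the second part with the lowered term. Where an exponent truncates, a binomial
coefficient is zero. -/
theorem sum_of_ladder_recurrence {R : Type*} [CommRing R] (u v : R) (a : ℕ → ℕ → R)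
    (h0 : ∀ k, a 0 (k + 1) = v * a 0 k)
    (hs : ∀ j k, a (j + 1) k = u * a j k - 2 * k * a j (k - 1)) (j k : ℕ) :
    a j k = (∑ l ∈ Finset.range (j + 1), (j.choose l * k.choose l * l.factorial : ℕ) *
      (-2) ^ l * u ^ (j - l) * v ^ (k - l)) * a 0 0 := by
  induction j generalizing k with
  | zero =>
    induction k with
    | zero => simp
    | succ k ih => rw [h0, ih]; simp [pow_succ]; ring
  | succ j ih =>
    rw [hs, ih, ih, ← mul_assoc, ← mul_assoc, ← sub_mul]
    congr 1
    rw [Finset.sum_range_succ' _ (j + 1)]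
    have h1 : ∀ l ∈ Finset.range (j + 1),
        (((j + 1).choose (l + 1) * k.choose (l + 1) * (l + 1).factorial : ℕ) : R) *
          (-2) ^ (l + 1) * u ^ (j + 1 - (l + 1)) * v ^ (k - (l + 1)) =
        u * ((j.choose (l + 1) * k.choose (l + 1) * (l + 1).factorial : ℕ) *
          (-2) ^ (l + 1) * u ^ (j - (l + 1)) * v ^ (k - (l + 1))) -
        2 * k * ((j.choose l * (k - 1).choose l * l.factorial : ℕ) *
          (-2) ^ l * u ^ (j - l) * v ^ (k - 1 - l)) := by
      intro l hl
      have hk : (k.choose (l + 1) * (l + 1) : R) = k * (k - 1).choose l := by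
        cases k with
        | zero => simp
        | succ k =>
          have := Nat.add_one_mul_choose_eq k l
          simp only [Nat.add_sub_cancel]
          exact_mod_cast congrArg (Nat.cast (R := R)) this.symm
      have hu : (j.choose (l + 1) : R) * u ^ (j - l) =
          u * (j.choose (l + 1) * u ^ (j - (l + 1))) := by
        rcases Nat.lt_or_ge l j with hlj | hlj
        · rw [show j - l = j - (l + 1) + 1 by omega]; ring
        · rw [Nat.choose_eq_zero_of_lt (by omega)]; simp
      rw [show j + 1 - (l + 1) = j - l by omega, show k - (l + 1) = k - 1 - l by omega,
        Nat.choose_succ_succ, Nat.factorial_succ]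
      push_cast
      linear_combination (k.choose (l + 1) * (l + 1) * l.factorial *
        (-2) ^ (l + 1) * v ^ (k - 1 - l) : R) * hu +
        (j.choose l * l.factorial * (-2) ^ (l + 1) * u ^ (j - l) * v ^ (k - 1 - l) : R) * hk
    rw [Finset.sum_congr rfl h1, Finset.sum_sub_distrib, ← Finset.mul_sum, ← Finset.mul_sum,
      sub_add_eq_add_sub]
    congr 1
    rw [Finset.sum_range_succ' _ j, Finset.sum_range_succ _ j,
      Nat.choose_eq_zero_of_lt (Nat.lt_succ_self j)]
    simp [pow_succ]
    ring

/-- `(-1)^k L_k(2s)`, with `L_k` the Laguerre polynomial of degree `k`. -/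
def signedLaguerre (k : ℕ) (s : ℝ) : ℝ :=
  ∑ m ∈ Finset.range (k + 1), (-1) ^ (k - m) * k.choose m * 2 ^ m * (s ^ m / m.factorial)

theorem hermiteCross_self (x y : ℝ) (k : ℕ) :
    hermiteCross x y k k = ((2 ^ k * k.factorial * signedLaguerre k (x ^ 2 + y ^ 2) : ℝ) : ℂ) *
      hermiteCross x y 0 0 := by
  rw [sum_of_ladder_recurrence (2 * (x - Complex.I * y) : ℂ) (2 * (x + Complex.I * y))
    (hermiteCross x y) (hermiteCross_zero_succ x y) (hermiteCross_succ_left x y) k k]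
  congr 1
  -- On the diagonal the surviving powers combine to `(uv)^(k - l)` with `uv = 4(x² + y²)`, so the
  -- Laguerre index is `m = k - l`.
  rw [signedLaguerre, Finset.mul_sum, Complex.ofReal_sum, ← Finset.sum_range_reflect]
  refine Finset.sum_congr rfl fun m hm => ?_
  have hmk : m ≤ k := Nat.lt_succ_iff.mp (Finset.mem_range.mp hm)
  have huv : (2 * (x - Complex.I * y) : ℂ) * (2 * (x + Complex.I * y)) =
      2 * 2 * ((x ^ 2 + y ^ 2 : ℝ) : ℂ) := by
    push_cast
    linear_combination (-4 * (y : ℂ) ^ 2) * Complex.I_sq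
  rw [show k + 1 - 1 - m = k - m by omega, Nat.choose_symm hmk, Nat.sub_sub_self hmk, mul_assoc,
    ← mul_pow, huv]
  have hf : (k.factorial : ℂ) = k.choose m * m.factorial * (k - m).factorial := by
    exact_mod_cast (Nat.choose_mul_factorial_mul_factorial hmk).symm
  have hm0 : (m.factorial : ℂ) ≠ 0 := by exact_mod_cast m.factorial_ne_zero
  have h2 : (2 : ℂ) ^ k = 2 ^ (k - m) * 2 ^ m := by rw [← pow_add, Nat.sub_add_cancel hmk]
  push_cast
  rw [hf, h2, neg_pow, mul_pow, mul_pow]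
  field_simp

theorem integral_hermiteFun_wigner (k : ℕ) (x y : ℝ) :
    ∫ τ : ℝ, ((hermiteFun k (x + 1 / 2 * τ) * hermiteFun k (x - 1 / 2 * τ) : ℝ) : ℂ) *
      Complex.exp (-Complex.I * (τ * y : ℝ)) =
    ((2 * (signedLaguerre k (x ^ 2 + y ^ 2) * Real.exp (-(x ^ 2 + y ^ 2))) : ℝ) : ℂ) := by
  have he : ∀ τ : ℝ, ((hermiteFun k (x + 1 / 2 * τ) * hermiteFun k (x - 1 / 2 * τ) : ℝ) : ℂ) *
      Complex.exp (-Complex.I * (τ * y : ℝ)) =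
      ((Real.pi ^ (-(1 / 2 : ℝ)) * (2 ^ k * Nat.factorial k : ℝ)⁻¹ * Real.exp (-x ^ 2) : ℝ) : ℂ) *
      ((shiftedHermite x (1 / 2) k * shiftedHermite x (-(1 / 2)) k).eval (τ : ℂ) *
        fourierGaussianWeight y τ) := fun τ => by
    have h1 : ∀ c : ℝ, (shiftedHermite x c k).eval (τ : ℂ) =
        ((physHermite k).eval (x + c * τ) : ℝ) := fun c => by
      rw [shiftedHermite, eval_comp]
      simp only [eval_add, eval_mul, eval_C, eval_X]
      rw [← Complex.ofReal_mul, ← Complex.ofReal_add]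
      rw [eval_map_algebraMap]
      exact aeval_algebraMap_apply (A := ℝ) ℂ _ _
    have h2 := h1 (1 / 2)
    have h3 := h1 (-(1 / 2))
    push_cast at h2 h3
    have h4 : ((Real.exp (-((x + 1 / 2 * τ) ^ 2 + (x - 1 / 2 * τ) ^ 2) / 2) : ℝ) : ℂ) *
        Complex.exp (-Complex.I * (τ * y : ℝ)) =
        (Real.exp (-x ^ 2) : ℝ) * fourierGaussianWeight y τ := by
      rw [fourierGaussianWeight]
      push_cast
      rw [← Complex.exp_add, ← Complex.exp_add]
      ring_nf
    rw [hermiteFun_mul, eval_mul, h2, h3]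
    rw [show x - 1 / 2 * τ = x + -(1 / 2) * τ by ring] at h4 ⊢
    rw [Complex.ofReal_mul, Complex.ofReal_mul (_ * _) (Real.exp _),
      Complex.ofReal_mul (_ * _) (Real.exp _)]
    rw [mul_assoc, mul_assoc, h4]
    push_cast
    ring
  simp_rw [he]
  rw [integral_const_mul]
  change _ * hermiteCross x y k k = _
  rw [hermiteCross_self]
  have h0 : hermiteCross x y 0 0 = ((2 * Real.pi ^ (1 / 2 : ℝ) * Real.exp (-y ^ 2) : ℝ) : ℂ) := by
    rw [hermiteCross, shiftedHermite_zero, shiftedHermite_zero, one_mul, gaussianFourier_one]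
    have : (Real.pi / (1 / 4) : ℂ) ^ (1 / 2 : ℂ) = ((2 * Real.pi ^ (1 / 2 : ℝ) : ℝ) : ℂ) := by
      have h4 : (4 : ℝ) ^ (1 / 2 : ℝ) = 2 := by
        rw [show (4 : ℝ) = 2 ^ (2 : ℝ) by norm_num, ← Real.rpow_mul (by norm_num)]; norm_num
      have h5 : (2 * Real.pi ^ (1 / 2 : ℝ) : ℝ) = (4 * Real.pi) ^ (1 / 2 : ℝ) := by
        rw [Real.mul_rpow (by norm_num) Real.pi_pos.le, h4]
      rw [h5, Complex.ofReal_cpow (by positivity)]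
      congr 1 <;> push_cast <;> ring
    rw [this]
    push_cast
    ring
  rw [h0, ← Complex.ofReal_mul, ← Complex.ofReal_mul]
  congr 1
  have hp : Real.pi ^ (-(1 / 2 : ℝ)) * Real.pi ^ (1 / 2 : ℝ) = 1 := by
    rw [← Real.rpow_add Real.pi_pos]; norm_num
  have hk : (2 ^ k * k.factorial : ℝ)⁻¹ * (2 ^ k * k.factorial) = 1 :=
    inv_mul_cancel₀ (by positivity)
  have hE : Real.exp (-(x ^ 2 + y ^ 2)) = Real.exp (-x ^ 2) * Real.exp (-y ^ 2) := by
    rw [← Real.exp_add]; ring_nf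
  rw [hE]
  linear_combination (2 * Real.exp (-x ^ 2) * Real.exp (-y ^ 2) *
    signedLaguerre k (x ^ 2 + y ^ 2)) * (hp * (2 ^ k * k.factorial : ℝ)⁻¹ * (2 ^ k * k.factorial) + hk)

end GaussianFunctional

end

noncomputable section

/-! ### Homogeneous densities on sublevel sets of a quadratic gauge -/

section Homogeneous
open scoped ENNReal
open Set

variable {E : Type*} [NormedAddCommGroup E] [NormedSpace ℝ E] [FiniteDimensional ℝ E]
  [MeasurableSpace E] [BorelSpace E] {μ : Measure E} [μ.IsAddHaarMeasure]

/-- Dilation by `√R` carries `{N < 1}` onto `{N < R}` and scales both integrals by the same factor.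
-/
theorem setLIntegral_lt_eq_of_homogeneous {N : E → ℝ} (hN : Measurable N)
    (hNs : ∀ (c : ℝ) z, N (c • z) = c ^ 2 * N z) {d : ℕ} {p q : E → ℝ≥0∞}
    (hp : Measurable p) (hq : Measurable q)
    (hps : ∀ c : ℝ, 0 < c → ∀ z, p (c • z) = ENNReal.ofReal c ^ d * p z)
    (hqs : ∀ c : ℝ, 0 < c → ∀ z, q (c • z) = ENNReal.ofReal c ^ d * q z)
    (h : ∫⁻ z in {z | N z < 1}, p z ∂μ = ∫⁻ z in {z | N z < 1}, q z ∂μ) {R : ℝ} (hR : 0 < R) :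
    ∫⁻ z in {z | N z < R}, p z ∂μ = ∫⁻ z in {z | N z < R}, q z ∂μ := by
  set c := √R
  have hc : 0 < c := Real.sqrt_pos.mpr hR
  have hc2 : c ^ 2 = R := Real.sq_sqrt hR.le
  have hm : ∀ S : ℝ, MeasurableSet {z | N z < S} := fun S => measurableSet_lt hN measurable_const
  have key : ∀ f : E → ℝ≥0∞, Measurable f →
      (∀ c : ℝ, 0 < c → ∀ z, f (c • z) = ENNReal.ofReal c ^ d * f z) →
      ENNReal.ofReal c ^ d * ∫⁻ z in {z | N z < 1}, f z ∂μ =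
      ENNReal.ofReal |(c ^ Module.finrank ℝ E)⁻¹| * ∫⁻ z in {z | N z < R}, f z ∂μ := by
    intro f hf hfs
    rw [← lintegral_indicator (hm R), ← smul_eq_mul (ENNReal.ofReal |_|), ← lintegral_smul_measure,
      ← Measure.map_addHaar_smul μ hc.ne', lintegral_map (hf.indicator (hm R)) (by fun_prop),
      ← lintegral_indicator (hm 1), ← lintegral_const_mul _ (hf.indicator (hm 1))]
    refine lintegral_congr fun z => ?_
    have : N (c • z) < R ↔ N z < 1 := by
      rw [hNs, hc2]; exact mul_lt_iff_lt_one_right hR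
    by_cases hz : N z < 1
    · simp [indicator, hz, this.2 hz, hfs c hc]
    · simp [indicator, hz, mt this.1 hz]
  have hw : ENNReal.ofReal |(c ^ Module.finrank ℝ E)⁻¹| ≠ 0 := by
    rw [ENNReal.ofReal_ne_zero_iff]; positivity
  rw [← ENNReal.mul_right_inj hw ENNReal.ofReal_ne_top, ← key p hp hps, ← key q hq hqs, h]

/-- The images under `N` of the measures with densities `p` and `q` agree on all half-lines `Iio R`.
They are finite there, so subtraction gives agreement on `Ico a b`, and the images coincide. -/
theorem lintegral_comp_mul_eq_of_homogeneous {N : E → ℝ} (hN : Measurable N) (hN0 : ∀ z, 0 ≤ N z)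
    (hNs : ∀ (c : ℝ) z, N (c • z) = c ^ 2 * N z) {d : ℕ} {p q : E → ℝ≥0∞}
    (hp : Measurable p) (hq : Measurable q)
    (hps : ∀ c : ℝ, 0 < c → ∀ z, p (c • z) = ENNReal.ofReal c ^ d * p z)
    (hqs : ∀ c : ℝ, 0 < c → ∀ z, q (c • z) = ENNReal.ofReal c ^ d * q z)
    (hfin : ∀ R : ℝ, ∫⁻ z in {z | N z < R}, p z ∂μ ≠ ∞)
    (h : ∫⁻ z in {z | N z < 1}, p z ∂μ = ∫⁻ z in {z | N z < 1}, q z ∂μ)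
    {F : ℝ → ℝ≥0∞} (hF : Measurable F) :
    ∫⁻ z, F (N z) * p z ∂μ = ∫⁻ z, F (N z) * q z ∂μ := by
  have hI : ∀ R : ℝ, ∫⁻ z in {z | N z < R}, p z ∂μ = ∫⁻ z in {z | N z < R}, q z ∂μ := by
    intro R
    rcases lt_or_ge 0 R with hR | hR
    · exact setLIntegral_lt_eq_of_homogeneous hN hNs hp hq hps hqs h hR
    · have : {z | N z < R} = ∅ := by
        ext z; simpa using hR.trans (hN0 z)
      simp [this]
  have hm : ∀ f : E → ℝ≥0∞, ∀ R, (μ.withDensity f).map N (Iio R) = ∫⁻ z in {z | N z < R}, f z ∂μ :=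
    fun f R => by
      rw [Measure.map_apply hN measurableSet_Iio,
        withDensity_apply _ (hN measurableSet_Iio)]
      rfl
  have hIco : ∀ f : E → ℝ≥0∞, (∀ R, ∫⁻ z in {z | N z < R}, f z ∂μ ≠ ∞) → ∀ a b, a < b →
      (μ.withDensity f).map N (Ico a b) =
      ∫⁻ z in {z | N z < b}, f z ∂μ - ∫⁻ z in {z | N z < a}, f z ∂μ := by
    intro f hf a b hab
    rw [← hm, ← hm, ← measure_sdiff (Iio_subset_Iio hab.le) measurableSet_Iio.nullMeasurableSet
      (by rw [hm]; exact hf a), Iio_sdiff_Iio]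
  have hmap : (μ.withDensity p).map N = (μ.withDensity q).map N := by
    refine Measure.ext_of_Ico' _ _ (fun a b hab => ?_) fun a b hab => ?_
    · exact ((measure_mono Ico_subset_Iio_self).trans_lt
        (by rw [hm]; exact (hfin b).lt_top)).ne
    · rw [hIco p hfin a b hab, hIco q (fun R => hI R ▸ hfin R) a b hab, hI, hI]
  have hl : ∀ f : E → ℝ≥0∞, Measurable f →
      ∫⁻ t, F t ∂((μ.withDensity f).map N) = ∫⁻ z, F (N z) * f z ∂μ := fun f hf => by
    rw [lintegral_map hF hN]
    refine (lintegral_withDensity_eq_lintegral_mul _ hf (hF.comp hN)).trans ?_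
    exact lintegral_congr fun z => mul_comm _ _
  rw [← hl p hp, ← hl q hq, hmap]

theorem lintegral_comp_mul_eq_of_homogeneous_of_gaussian {N : E → ℝ} (hN : Measurable N)
    (hN0 : ∀ z, 0 ≤ N z) (hNs : ∀ (c : ℝ) z, N (c • z) = c ^ 2 * N z) {d : ℕ} {p q : E → ℝ≥0∞}
    (hp : Measurable p) (hq : Measurable q)
    (hps : ∀ c : ℝ, 0 < c → ∀ z, p (c • z) = ENNReal.ofReal c ^ d * p z)
    (hqs : ∀ c : ℝ, 0 < c → ∀ z, q (c • z) = ENNReal.ofReal c ^ d * q z)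
    (h : ∫⁻ z, ENNReal.ofReal (Real.exp (-N z)) * p z ∂μ =
      ∫⁻ z, ENNReal.ofReal (Real.exp (-N z)) * q z ∂μ)
    (h0 : ∫⁻ z, ENNReal.ofReal (Real.exp (-N z)) * p z ∂μ ≠ 0)
    (ht : ∫⁻ z, ENNReal.ofReal (Real.exp (-N z)) * p z ∂μ ≠ ∞)
    {F : ℝ → ℝ≥0∞} (hF : Measurable F) :
    ∫⁻ z, F (N z) * p z ∂μ = ∫⁻ z, F (N z) * q z ∂μ := by
  have hfin : ∀ f : E → ℝ≥0∞, Measurable f →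
      ∫⁻ z, ENNReal.ofReal (Real.exp (-N z)) * f z ∂μ ≠ ∞ →
      ∀ R : ℝ, ∫⁻ z in {z | N z < R}, f z ∂μ ≠ ∞ := by
    intro f hf hft R
    -- On `{N < R}` the factor `e^R e^(-N)` is at least `1`, so the Gaussian integral bounds the
    -- mass.
    have hle : ∫⁻ z in {z | N z < R}, f z ∂μ ≤
        ∫⁻ z in {z | N z < R}, ENNReal.ofReal (Real.exp R) *
          (ENNReal.ofReal (Real.exp (-N z)) * f z) ∂μ := by
      refine setLIntegral_mono (by fun_prop) fun z hz => ?_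
      rw [← mul_assoc, ← ENNReal.ofReal_mul (Real.exp_pos _).le, ← Real.exp_add]
      refine le_mul_of_one_le_left' ?_
      rw [ENNReal.one_le_ofReal, Real.one_le_exp_iff]
      have : N z < R := hz
      linarith
    refine (hle.trans (setLIntegral_le_lintegral _ _)).trans_lt ?_ |>.ne
    rw [lintegral_const_mul _ (by fun_prop)]
    exact ENNReal.mul_lt_top ENNReal.ofReal_lt_top hft.lt_top
  have hpf := hfin p hp ht
  have hqf := hfin q hq (h ▸ ht)
  set A := ∫⁻ z in {z | N z < 1}, p z ∂μ with hA
  set B := ∫⁻ z in {z | N z < 1}, q z ∂μ with hB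
  have hAB : A = B := by
    -- `B p` and `A q` have the same mass on `{N < 1}`, hence the same Gaussian integral. Cancelling
    -- the common Gaussian integral of `p` and `q`, finite and nonzero, leaves `A = B`.
    have := lintegral_comp_mul_eq_of_homogeneous (μ := μ) hN hN0 hNs (d := d)
      (hp.const_mul B) (hq.const_mul A)
      (fun c hc z => by rw [hps c hc]; ring) (fun c hc z => by rw [hqs c hc]; ring)
      (fun R => by
        rw [lintegral_const_mul _ hp]; exact ENNReal.mul_ne_top (hqf 1) (hpf R))
      (by rw [lintegral_const_mul _ hp, lintegral_const_mul _ hq, ← hA, ← hB, mul_comm])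
      (F := fun t => ENNReal.ofReal (Real.exp (-t))) (by fun_prop)
    simp_rw [mul_left_comm _ A, mul_left_comm _ B] at this
    rw [lintegral_const_mul _ (by fun_prop), lintegral_const_mul _ (by fun_prop), ← h,
      ENNReal.mul_left_inj h0 ht] at this
    exact this.symm
  exact lintegral_comp_mul_eq_of_homogeneous hN hN0 hNs hp hq hps hqs hpf hAB hF

theorem setIntegral_gaussian_mul_eq_of_homogeneous {N : E → ℝ} (hN : Measurable N)
    (hN0 : ∀ z, 0 ≤ N z) (hNs : ∀ (c : ℝ) z, N (c • z) = c ^ 2 * N z) {d : ℕ} {p q : E → ℝ}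
    (hp : Measurable p) (hq : Measurable q) (hp0 : ∀ z, 0 ≤ p z) (hq0 : ∀ z, 0 ≤ q z)
    (hps : ∀ (c : ℝ) z, p (c • z) = c ^ d * p z)
    (hqs : ∀ (c : ℝ) z, q (c • z) = c ^ d * q z)
    (h : ∫ z, Real.exp (-N z) * p z ∂μ = ∫ z, Real.exp (-N z) * q z ∂μ)
    (h0 : ∫ z, Real.exp (-N z) * p z ∂μ ≠ 0) (R : ℝ) :
    ∫ z in {z | N z ≤ R}, Real.exp (-N z) * p z ∂μ =
      ∫ z in {z | N z ≤ R}, Real.exp (-N z) * q z ∂μ := by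
  have hs : ∀ f : E → ℝ, (∀ (c : ℝ) z, f (c • z) = c ^ d * f z) → ∀ c : ℝ, 0 < c → ∀ z,
      ENNReal.ofReal (f (c • z)) = ENNReal.ofReal c ^ d * ENNReal.ofReal (f z) := fun f hf c hc z => by
    rw [hf, ENNReal.ofReal_mul (by positivity), ENNReal.ofReal_pow hc.le]
  -- A nonzero Bochner integral forces integrability, so no separate hypothesis is needed.
  have hl : ∀ f : E → ℝ, (∀ z, 0 ≤ f z) → ∫ z, Real.exp (-N z) * f z ∂μ ≠ 0 →
      ENNReal.ofReal (∫ z, Real.exp (-N z) * f z ∂μ) =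
      ∫⁻ z, ENNReal.ofReal (Real.exp (-N z)) * ENNReal.ofReal (f z) ∂μ := fun f hf hf0 => by
    rw [ofReal_integral_eq_lintegral_ofReal (Integrable.of_integral_ne_zero hf0)
      (Filter.Eventually.of_forall fun z => mul_nonneg (Real.exp_pos _).le (hf z))]
    exact lintegral_congr fun z => ENNReal.ofReal_mul (Real.exp_pos _).le
  have hlp := hl p hp0 h0
  have hlq := hl q hq0 (h ▸ h0)
  have hm : MeasurableSet {z | N z ≤ R} := measurableSet_le hN measurable_const
  have hset : ∀ f : E → ℝ, Measurable f → (∀ z, 0 ≤ f z) →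
      ∫ z in {z | N z ≤ R}, Real.exp (-N z) * f z ∂μ =
      (∫⁻ z, (Iic R).indicator (fun t => ENNReal.ofReal (Real.exp (-t))) (N z) *
        ENNReal.ofReal (f z) ∂μ).toReal := fun f hf hf0 => by
    rw [integral_eq_lintegral_of_nonneg_ae
      (Filter.Eventually.of_forall fun z => mul_nonneg (Real.exp_pos _).le (hf0 z))
      (by fun_prop), ← lintegral_indicator hm]
    congr 1
    refine lintegral_congr fun z => ?_
    by_cases hz : N z ≤ R
    · simp [indicator, hz, ENNReal.ofReal_mul (Real.exp_pos _).le]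
    · simp [indicator, hz]
  rw [hset p hp hp0, hset q hq hq0]
  congr 1
  refine lintegral_comp_mul_eq_of_homogeneous_of_gaussian hN hN0 hNs (by fun_prop) (by fun_prop)
    (hs p hps) (hs q hqs) (by rw [← hlp, ← hlq, h]) ?_ ?_
    (Measurable.indicator (by fun_prop) measurableSet_Iic)
  · rw [← hlp, ENNReal.ofReal_ne_zero_iff]
    exact lt_of_le_of_ne
      (integral_nonneg fun z => mul_nonneg (Real.exp_pos _).le (hp0 z)) h0.symm
  · rw [← hlp]; exact ENNReal.ofReal_ne_top

end Homogeneous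

/-! ### Gaussian moments on phase space -/

section PhaseSpace

variable {n : ℕ}

/-- On the complex plane the unnormalized moment is `π Γ(m + 1)`; dividing by `m!` makes it
independent of `m`. -/
theorem integral_sq_add_sq_pow_mul_exp (m : ℕ) :
    ∫ w : ℝ × ℝ, Real.exp (-(w.1 ^ 2 + w.2 ^ 2)) * ((w.1 ^ 2 + w.2 ^ 2) ^ m / m.factorial) =
      Real.pi := by
  have h := Complex.integral_rpow_mul_exp_neg_rpow (p := 2) (q := 2 * m) (by norm_num)
    (by have : (0 : ℝ) ≤ m := m.cast_nonneg
        linarith)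
  rw [show (2 * (m : ℝ) + 2) / 2 = m + 1 by ring, Real.Gamma_nat_eq_factorial] at h
  rw [← Complex.volume_preserving_equiv_real_prod.integral_comp
    Complex.measurableEquivRealProd.measurableEmbedding]
  have e : ∀ w : ℂ, Real.exp (-((Complex.measurableEquivRealProd w).1 ^ 2 +
      (Complex.measurableEquivRealProd w).2 ^ 2)) *
      (((Complex.measurableEquivRealProd w).1 ^ 2 +
      (Complex.measurableEquivRealProd w).2 ^ 2) ^ m / m.factorial) =
      (m.factorial : ℝ)⁻¹ * (‖w‖ ^ (2 * m : ℝ) * Real.exp (-‖w‖ ^ (2 : ℝ))) := fun w => by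
    have hw : w.re ^ 2 + w.im ^ 2 = ‖w‖ ^ 2 := by
      rw [Complex.sq_norm, Complex.normSq_apply]; ring
    rw [Complex.measurableEquivRealProd_apply, hw, Real.rpow_two,
      show (2 * m : ℝ) = ((2 * m : ℕ) : ℝ) by push_cast; rfl, Real.rpow_natCast, pow_mul]
    ring
  simp_rw [e]
  rw [integral_const_mul, h]
  have := Nat.factorial_ne_zero m
  field_simp

/-- The map that groups the coordinates of phase space into pairs of conjugate variables. -/
def phaseOfPairs (n : ℕ) (w : Fin n → ℝ × ℝ) :
    EuclideanSpace ℝ (Fin n) × EuclideanSpace ℝ (Fin n) :=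
  (WithLp.toLp 2 fun j => (w j).1, WithLp.toLp 2 fun j => (w j).2)

theorem integral_comp_phaseOfPairs
    (f : EuclideanSpace ℝ (Fin n) × EuclideanSpace ℝ (Fin n) → ℝ) :
    ∫ w, f (phaseOfPairs n w) = ∫ z, f z := by
  let e : (Fin n → ℝ × ℝ) ≃ᵐ EuclideanSpace ℝ (Fin n) × EuclideanSpace ℝ (Fin n) :=
    (MeasurableEquiv.arrowProdEquivProdArrow ℝ ℝ (Fin n)).trans
      ((MeasurableEquiv.toLp 2 _).prodCongr (MeasurableEquiv.toLp 2 _))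
  have he : MeasurePreserving e := by
    have h1 := volume_measurePreserving_arrowProdEquivProdArrow ℝ ℝ (Fin n)
    have h2 := (PiLp.volume_preserving_toLp (Fin n)).prod (PiLp.volume_preserving_toLp (Fin n))
    exact h2.comp h1
  exact he.integral_comp e.measurableEmbedding f

/-- The normalized monomial `∏ j, (x_j² + y_j²)^(m_j) / m_j!`. -/
def actionMonomial (m : Fin n → ℕ)
    (z : EuclideanSpace ℝ (Fin n) × EuclideanSpace ℝ (Fin n)) : ℝ :=
  ∏ j, (z.1 j ^ 2 + z.2 j ^ 2) ^ m j / (m j).factorial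

theorem norm_sq_add_norm_sq (z : EuclideanSpace ℝ (Fin n) × EuclideanSpace ℝ (Fin n)) :
    ‖z.1‖ ^ 2 + ‖z.2‖ ^ 2 = ∑ j, (z.1 j ^ 2 + z.2 j ^ 2) := by
  rw [EuclideanSpace.real_norm_sq_eq, EuclideanSpace.real_norm_sq_eq, Finset.sum_add_distrib]

theorem continuous_actionMonomial (m : Fin n → ℕ) : Continuous (actionMonomial m) := by
  unfold actionMonomial
  fun_prop

theorem integral_exp_mul_actionMonomial (m : Fin n → ℕ) :
    ∫ z, Real.exp (-(‖z.1‖ ^ 2 + ‖z.2‖ ^ 2)) * actionMonomial m z = Real.pi ^ n := by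
  rw [← integral_comp_phaseOfPairs]
  let g : Fin n → ℝ × ℝ → ℝ := fun j v => Real.exp (-(v.1 ^ 2 + v.2 ^ 2)) *
    ((v.1 ^ 2 + v.2 ^ 2) ^ m j / (m j).factorial)
  have e : ∀ w : Fin n → ℝ × ℝ, Real.exp (-(‖(phaseOfPairs n w).1‖ ^ 2 +
      ‖(phaseOfPairs n w).2‖ ^ 2)) * actionMonomial m (phaseOfPairs n w) =
      ∏ j, g j (w j) := fun w => by
    rw [norm_sq_add_norm_sq, actionMonomial, ← Finset.sum_neg_distrib, Real.exp_sum,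
      ← Finset.prod_mul_distrib]
    rfl
  refine (integral_congr_ae (Filter.Eventually.of_forall e)).trans
    ((integral_fintype_prod_volume_eq_prod g).trans ?_)
  simp only [g, integral_sq_add_sq_pow_mul_exp, Finset.prod_const, Finset.card_univ,
    Fintype.card_fin]

theorem setIntegral_phaseBall_actionMonomial_eq {m m' : Fin n → ℕ} (h : ∑ j, m j = ∑ j, m' j)
    (r : ℝ) :
    ∫ z in phaseBall n r, Real.exp (-(‖z.1‖ ^ 2 + ‖z.2‖ ^ 2)) * actionMonomial m z =
      ∫ z in phaseBall n r, Real.exp (-(‖z.1‖ ^ 2 + ‖z.2‖ ^ 2)) * actionMonomial m' z := by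
  have hs : ∀ (k : Fin n → ℕ) (c : ℝ) z,
      actionMonomial k (c • z) = c ^ (2 * ∑ j, k j) * actionMonomial k z := fun k c z => by
    simp only [actionMonomial, Finset.mul_sum, ← Finset.prod_pow_eq_pow_sum,
      ← Finset.prod_mul_distrib]
    refine Finset.prod_congr rfl fun j _ => ?_
    simp only [Prod.smul_fst, Prod.smul_snd, PiLp.smul_apply, smul_eq_mul]
    rw [pow_mul, ← mul_div_assoc, ← mul_pow]
    ring_nf
  have h0 : ∀ (k : Fin n → ℕ) z, 0 ≤ actionMonomial k z := fun k z =>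
    Finset.prod_nonneg fun j _ => by positivity
  have : (volume : Measure (EuclideanSpace ℝ (Fin n) × EuclideanSpace ℝ (Fin n))).IsAddHaarMeasure :=
    inferInstanceAs ((volume : Measure (EuclideanSpace ℝ (Fin n))).prod
      (volume : Measure (EuclideanSpace ℝ (Fin n)))).IsAddHaarMeasure
  refine setIntegral_gaussian_mul_eq_of_homogeneous (d := 2 * ∑ j, m j)
    (N := fun z : EuclideanSpace ℝ (Fin n) × EuclideanSpace ℝ (Fin n) => ‖z.1‖ ^ 2 + ‖z.2‖ ^ 2)
    (by fun_prop) (fun z => by positivity) (fun c z => ?_)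
    (continuous_actionMonomial m).measurable (continuous_actionMonomial m').measurable (h0 m)
    (h0 m') (hs m) (fun c z => by rw [h]; exact hs m' c z)
    (by rw [integral_exp_mul_actionMonomial, integral_exp_mul_actionMonomial])
    (by rw [integral_exp_mul_actionMonomial]; positivity) (r ^ 2)
  simp only [Prod.smul_fst, Prod.smul_snd, norm_smul, mul_pow, Real.norm_eq_abs, sq_abs]
  ring

end PhaseSpace

end

noncomputable section

/-! ### Product formula for the Wigner distribution and the linear functional -/

section Assembly

variable {n : ℕ}

/-- The integrand factors over the coordinates of `τ`, so Fubini reduces to dimension one; the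
factors `2` there cancel the `2^n` in `(2π)^n`. -/
theorem wigner_multiHermite (μ : Fin n → ℕ)
    (z : EuclideanSpace ℝ (Fin n) × EuclideanSpace ℝ (Fin n)) :
    wigner (multiHermite μ) z = ((Real.pi ^ n)⁻¹ * (Real.exp (-(‖z.1‖ ^ 2 + ‖z.2‖ ^ 2)) *
      ∏ j, signedLaguerre (μ j) (z.1 j ^ 2 + z.2 j ^ 2)) : ℝ) := by
  rw [wigner, ← (PiLp.volume_preserving_toLp (Fin n)).integral_comp
    (MeasurableEquiv.toLp 2 _).measurableEmbedding]
  let g : Fin n → ℝ → ℂ := fun j t => ((hermiteFun (μ j) (z.1 j + 1 / 2 * t) *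
    hermiteFun (μ j) (z.1 j - 1 / 2 * t) : ℝ) : ℂ) * Complex.exp (-Complex.I * (t * z.2 j : ℝ))
  have e : ∀ τ : Fin n → ℝ, multiHermite μ (z.1 + (1 / 2 : ℝ) • WithLp.toLp 2 τ) *
      (starRingEnd ℂ) (multiHermite μ (z.1 - (1 / 2 : ℝ) • WithLp.toLp 2 τ)) *
      Complex.exp (-Complex.I * ((inner ℝ (WithLp.toLp 2 τ) z.2 : ℝ) : ℂ)) =
      ∏ j, g j (τ j) := fun τ => by
    rw [multiHermite, multiHermite, Complex.conj_ofReal, ← Complex.ofReal_mul,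
      ← Finset.prod_mul_distrib, Complex.ofReal_prod, PiLp.inner_apply, Complex.ofReal_sum,
      Finset.mul_sum, Complex.exp_sum, ← Finset.prod_mul_distrib]
    refine Finset.prod_congr rfl fun j _ => ?_
    simp [g, mul_comm]
  rw [integral_congr_ae (Filter.Eventually.of_forall e),
    integral_fintype_prod_volume_eq_prod g]
  simp_rw [g, integral_hermiteFun_wigner]
  rw [← Complex.ofReal_prod, ← Complex.ofReal_inv, ← Complex.ofReal_pow, ← Complex.ofReal_mul,
    Finset.prod_mul_distrib, Finset.prod_mul_distrib, ← Real.exp_sum, Finset.sum_neg_distrib,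
    ← norm_sq_add_norm_sq]
  congr 1
  rw [Finset.prod_const, Finset.card_univ, Fintype.card_fin, inv_pow, mul_pow, mul_inv]
  field_simp

theorem isCompact_phaseBall (r : ℝ) : IsCompact (phaseBall n r) := by
  refine Metric.isCompact_of_isClosed_isBounded
    (isClosed_le (by fun_prop) continuous_const) ?_
  refine (Metric.isBounded_iff_subset_closedBall 0).mpr ⟨|r|, fun z hz => ?_⟩
  have hz' : ‖z.1‖ ^ 2 + ‖z.2‖ ^ 2 ≤ r ^ 2 := hz
  rw [mem_closedBall_zero_iff, Prod.norm_def, max_le_iff]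
  constructor
  · exact abs_norm z.1 ▸ sq_le_sq.mp (by nlinarith [sq_nonneg ‖z.2‖])
  · exact abs_norm z.2 ▸ sq_le_sq.mp (by nlinarith [sq_nonneg ‖z.1‖])

theorem continuous_wigner_multiHermite (μ : Fin n → ℕ) :
    Continuous (wigner (multiHermite μ)) := by
  rw [funext (wigner_multiHermite μ)]
  unfold signedLaguerre
  fun_prop

/-- The coefficients of `(2X - 1)^k`. -/
def laguerreCoeff (k m : ℕ) : ℝ := (-1) ^ (k - m) * k.choose m * 2 ^ m

open Polynomial in
theorem sum_monomial_laguerreCoeff (k : ℕ) :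
    ∑ m ∈ Finset.range (k + 1), C (laguerreCoeff k m) * X ^ m = (2 * X - 1 : ℝ[X]) ^ k := by
  rw [sub_eq_add_neg, add_pow]
  refine Finset.sum_congr rfl fun m _ => ?_
  have h2 : (C 2 : ℝ[X]) = 2 := rfl
  simp [laguerreCoeff, mul_pow, h2]
  ring

open Polynomial in
theorem exists_setIntegral_phaseBall_eq (n : ℕ) (r : ℝ) : ∃ c : ℝ[X] →ₗ[ℝ] ℝ, ∀ μ : Fin n → ℕ,
    ∫ z in phaseBall n r, Real.exp (-(‖z.1‖ ^ 2 + ‖z.2‖ ^ 2)) *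
      ∏ j, signedLaguerre (μ j) (z.1 j ^ 2 + z.2 j ^ 2) = c ((2 * X - 1) ^ ∑ j, μ j) := by
  classical
  let I : (Fin n → ℕ) → ℝ := fun m =>
    ∫ z in phaseBall n r, Real.exp (-(‖z.1‖ ^ 2 + ‖z.2‖ ^ 2)) * actionMonomial m z
  -- `I` factors through the total degree. Degrees that are not attained, as when `n = 0`, get the
  -- value `0`.
  obtain ⟨c₀, hc₀⟩ : ∃ c₀ : ℕ → ℝ, ∀ m, I m = c₀ (∑ j, m j) :=
    ⟨Function.extend (fun m : Fin n → ℕ => ∑ j, m j) I 0, fun m =>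
      (Function.FactorsThrough.extend_apply (g := I) (f := fun m : Fin n → ℕ => ∑ j, m j)
        (fun _ _ h => setIntegral_phaseBall_actionMonomial_eq h r) 0 m).symm⟩
  refine ⟨(basisMonomials ℝ).constr ℝ c₀, fun μ => ?_⟩
  have hc : ∀ (a : ℝ) (M : ℕ), (basisMonomials ℝ).constr ℝ c₀ (C a * X ^ M) = a * c₀ M := by
    intro a M
    have h := (basisMonomials ℝ).constr_basis ℝ c₀ M
    rw [coe_basisMonomials] at h
    rw [← smul_eq_C_mul, map_smul, X_pow_eq_monomial, h, smul_eq_mul]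
  have hexp : ∀ z : EuclideanSpace ℝ (Fin n) × EuclideanSpace ℝ (Fin n),
      Real.exp (-(‖z.1‖ ^ 2 + ‖z.2‖ ^ 2)) *
        ∏ j, signedLaguerre (μ j) (z.1 j ^ 2 + z.2 j ^ 2) =
      ∑ m ∈ Fintype.piFinset fun j => Finset.range (μ j + 1), (∏ j, laguerreCoeff (μ j) (m j)) *
        (Real.exp (-(‖z.1‖ ^ 2 + ‖z.2‖ ^ 2)) * actionMonomial m z) := fun z => by
    simp only [signedLaguerre]
    rw [Finset.prod_univ_sum, Finset.mul_sum]
    refine Finset.sum_congr rfl fun m _ => ?_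
    rw [actionMonomial, Finset.prod_mul_distrib]
    simp only [laguerreCoeff]
    ring
  simp_rw [hexp]
  rw [integral_finsetSum]
  · simp_rw [integral_const_mul]
    -- Expanding `∏ j, (2X - 1)^(μ_j)` over the same multi-indices gives the same coefficients, with
    -- `X^(∑ m_j)` in place of each monomial integral.
    rw [← Finset.prod_pow_eq_pow_sum]
    simp_rw [← sum_monomial_laguerreCoeff]
    rw [Finset.prod_univ_sum, map_sum]
    refine Finset.sum_congr rfl fun m _ => ?_
    rw [Finset.prod_mul_distrib, Finset.prod_pow_eq_pow_sum, ← map_prod, hc, ← hc₀]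
  · intro m _
    have := continuous_actionMonomial m
    exact ((by fun_prop : Continuous _).continuousOn.integrableOn_compact
      (isCompact_phaseBall r))

end Assembly

end

theorem lemma2 (n lam : ℕ) (μ₁ μ₂ : Fin n → ℕ)
    (h₁ : ∑ j, μ₁ j = lam) (h₂ : ∑ j, μ₂ j = lam) (r : ℝ) (hr : 0 ≤ r) :
    IntegrableOn (wigner (multiHermite μ₁)) (phaseBall n r) ∧
    IntegrableOn (wigner (multiHermite μ₂)) (phaseBall n r) ∧
    ∫ z in phaseBall n r, wigner (multiHermite μ₁) z =
      ∫ z in phaseBall n r, wigner (multiHermite μ₂) z := by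
  refine ⟨(continuous_wigner_multiHermite μ₁).continuousOn.integrableOn_compact
    (isCompact_phaseBall r), (continuous_wigner_multiHermite μ₂).continuousOn.integrableOn_compact
    (isCompact_phaseBall r), ?_⟩
  obtain ⟨c, hc⟩ := exists_setIntegral_phaseBall_eq n r
  simp_rw [wigner_multiHermite]
  rw [integral_complex_ofReal, integral_complex_ofReal, integral_const_mul, integral_const_mul,
    hc, hc, h₁, h₂]
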